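/- Let $\mathcal N_d$ be the standard Gaussian probability measure on $\mathbb R^d$. For a random vector $X$ in $\mathbb R^d$, let $\nabla\varphi$ be the monotone transport from $\mathcal N_d$ onto the law of $X$, that is, the $\mathcal N_d$-almost everywhere defined gradient of a convex function $\varphi:\mathbb R^d\to\mathbb R$ such that the image of $\mathcal N_d$ under $\nabla\varphi$ is the law of $X$ (it is unique $\mathcal N_d$-almost everywhere). For a multi-index $\alpha=(\alpha_1,\dots,\alpha_d)$ of positive integers put $H_\alpha(x)=\prod_{k=1}^d H_{\alpha_k-1}(x_k)$, where $H_0=1$, $H_1(t)=t$, $H_2(t)=t^2-1,\dots$ are the (probabilists') Hermite polynomials, so that $H_{(1,\dots,1)}=1$. The Hermite L-moments of $X$, and its L-moment matrix of degree $2$, are $$\lambda_\alpha(X)=\int_{\mathbb R^d}\nabla\varphi(x)\,H_\alpha(x)\,d\mathcal N_d(x)\in\mathbb R^d,\qquad \Lambda_2(X)=\Big(\int_{\mathbb R^d}(\nabla\varphi)_i(x)\,x_j\,d\mathcal N_d(x)\Big)_{i,j=1,\dots,d},$$ whenever the integrals converge absolutely. 1. Let $\sigma>0$, $m\in\mathbb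 R^d$, and let $\alpha$ be such that $\lambda_\alpha(X)$ exists. Then $\lambda_\alpha(\sigma X+m)$ exists and $$\lambda_\alpha(\sigma X+m)=\sigma\lambda_\alpha(X)+m\,\mathbf 1_{\alpha=(1,\dots,1)}.$$ 2. Suppose that $\Lambda_2(X)$ exists and let $P$ be an orthogonal $d\times d$ matrix. Then $\Lambda_2(P^TX)$ exists and $$\Lambda_2(P^TX)=P^T\Lambda_2(X)\,P$$ (equivalently, replacing $P$ by $P^T$, $\Lambda_2(PX)=P\Lambda_2(X)P^T$ for every orthogonal $P$). -/

import Mathlib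

open MeasureTheory ProbabilityTheory
open scoped Gradient

namespace HermiteLMoments

/-- `φ` is a convex potential whose gradient transports the standard Gaussian measure of `ℝ^d`
onto `ν`. The convex function `φ` is differentiable almost everywhere; `∇ φ x` is the total
function of Mathlib, with the irrelevant value `0` on the null set where `φ` has no gradient. -/
structure IsTransportPotential {d : ℕ} (φ : EuclideanSpace ℝ (Fin d) → ℝ)
    (ν : Measure (EuclideanSpace ℝ (Fin d))) : Prop where
  convex : ConvexOn ℝ Set.univ φ
  differentiable : ∀ᵐ x ∂(stdGaussian (EuclideanSpace ℝ (Fin d))), DifferentiableAt ℝ φ x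
  map_gradient : (stdGaussian (EuclideanSpace ℝ (Fin d))).map (∇ φ) = ν

open Classical in
/-- The monotone transport from the standard Gaussian measure onto `ν`: the gradient of a convex
potential pushing the former to the latter (and `0` should there be none). -/
noncomputable def monotoneTransport {d : ℕ} (ν : Measure (EuclideanSpace ℝ (Fin d))) :
    EuclideanSpace ℝ (Fin d) → EuclideanSpace ℝ (Fin d) :=
  if h : ∃ φ : EuclideanSpace ℝ (Fin d) → ℝ, IsTransportPotential φ ν then ∇ (h.choose) else 0

/-- The multivariate Hermite polynomial of the multi-index `α = (α₁, …, α_d)` of positive integers: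
the product of the (probabilists') Hermite polynomials `H_{α_k - 1}(x_k)`. The constant polynomial
`1` thus has index `(1, …, 1)`, the index of the L-moment of degree one. -/
noncomputable def hermitePoly {d : ℕ} (α : Fin d → ℕ+) (x : EuclideanSpace ℝ (Fin d)) : ℝ :=
  ∏ k, Polynomial.aeval (x k) (Polynomial.hermite ((α k : ℕ) - 1))

/-- The Hermite L-moment of index `α` of the law `ν` exists. -/
def HasHermiteLMoment {d : ℕ} (ν : Measure (EuclideanSpace ℝ (Fin d))) (α : Fin d → ℕ+) : Prop :=
  Integrable (fun x => hermitePoly α x • monotoneTransport ν x)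
    (stdGaussian (EuclideanSpace ℝ (Fin d)))

/-- The Hermite L-moment `λ_α = ∫ T(x) H_α(x) dN_d(x) ∈ ℝ^d` of the law `ν`. -/
noncomputable def hermiteLMoment {d : ℕ} (ν : Measure (EuclideanSpace ℝ (Fin d)))
    (α : Fin d → ℕ+) : EuclideanSpace ℝ (Fin d) :=
  ∫ x, hermitePoly α x • monotoneTransport ν x ∂(stdGaussian (EuclideanSpace ℝ (Fin d)))

/-- All entries of the Hermite L-moment matrix of degree two of the law `ν` exist. -/
def HasHermiteLMatrix {d : ℕ} (ν : Measure (EuclideanSpace ℝ (Fin d))) : Prop :=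
  ∀ i j, Integrable (fun x => monotoneTransport ν x i * x j)
    (stdGaussian (EuclideanSpace ℝ (Fin d)))

/-- The Hermite L-moment matrix of degree two, `Λ₂ = (∫ T_i(x) x_j dN_d(x))_{i,j}`. -/
noncomputable def hermiteLMatrix {d : ℕ} (ν : Measure (EuclideanSpace ℝ (Fin d))) :
    Matrix (Fin d) (Fin d) ℝ :=
  Matrix.of fun i j =>
    ∫ x, monotoneTransport ν x i * x j ∂(stdGaussian (EuclideanSpace ℝ (Fin d)))

end HermiteLMoments

/-! If `∇ φ` is the monotone transport onto the law of X, then σ∇φ + m is the gradient of the convex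
function σφ + ⟨m, ·⟩, and Uᵀ∇φ(U·), for orthogonal U, is the gradient of φ ∘ U. They carry the
Gaussian onto the laws of σX + m and UᵀX, the latter by rotation invariance. The claims then follow
from linearity of the integral, the Gaussian means of the `hermitePoly α`, and the change of
variable U.

`monotoneTransport` picks an arbitrary potential, so everything rests on almost everywhere
uniqueness, `gradient_ae_eq_of_map_eq`. It is proved by an Aleksandrov–McCann type comparison of two
potentials, without any moment assumption. -/

namespace HermiteLMoments

/-! ### Uniqueness of gradients of convex functions with a given image measure. -/

section Convex

variable {E : Type*} [NormedAddCommGroup E] [InnerProductSpace ℝ E]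

/-- The convex conjugate of a function. -/
noncomputable def convexConjugate (f : E → ℝ) (y : E) : EReal :=
  ⨆ z : E, ((inner ℝ y z - f z : ℝ) : EReal)

/-- A supremum of continuous functions is lower semicontinuous. This makes the set `A` of the
uniqueness argument Borel, so that the image measures can be compared on it. -/
lemma measurable_convexConjugate [MeasurableSpace E] [BorelSpace E] (f : E → ℝ) :
    Measurable (convexConjugate f) := by
  refine LowerSemicontinuous.measurable (lowerSemicontinuous_iSup fun z => ?_)
  refine Continuous.lowerSemicontinuous ?_
  exact continuous_coe_real_ereal.comp (by fun_prop)

lemma le_convexConjugate (f : E → ℝ) (y z : E) :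
    ((inner ℝ y z - f z : ℝ) : EReal) ≤ convexConjugate f y :=
  le_iSup (fun z : E => ((inner ℝ y z - f z : ℝ) : EReal)) z

variable [FiniteDimensional ℝ E]

/-- A differentiable convex function lies above its tangent hyperplanes. -/
lemma add_inner_gradient_le {f : E → ℝ} (hf : ConvexOn ℝ Set.univ f) {x : E}
    (hx : DifferentiableAt ℝ f x) (z : E) : f x + inner ℝ ((∇ f) x) (z - x) ≤ f z := by
  have hline : HasDerivAt (fun t : ℝ => x + t • (z - x)) (z - x) 0 := by
    simpa using ((hasDerivAt_id (0 : ℝ)).smul_const (z - x)).const_add x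
  have hx' : HasFDerivAt f (fderiv ℝ f x) (x + (0 : ℝ) • (z - x)) := by
    simpa using hx.hasFDerivAt
  have hd : HasDerivAt (fun t : ℝ => f (x + t • (z - x))) (fderiv ℝ f x (z - x)) 0 :=
    hx'.comp_hasDerivAt 0 hline
  have hc : ConvexOn ℝ Set.univ (fun t : ℝ => f (x + t • (z - x))) := by
    refine ⟨convex_univ, fun a _ b _ r s hr hs hrs => ?_⟩
    have h := hf.2 (Set.mem_univ (x + a • (z - x))) (Set.mem_univ (x + b • (z - x))) hr hs hrs
    refine le_trans (le_of_eq ?_) h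
    rw [smul_add, smul_add, add_add_add_comm, ← add_smul, hrs, one_smul, smul_smul, smul_smul,
      ← add_smul]
    simp
  have h := hc.le_slope_of_hasDerivAt (Set.mem_univ 0) (Set.mem_univ 1) one_pos hd
  rw [inner_gradient_left]
  simp only [slope_def_field, one_smul, zero_smul, add_sub_cancel, add_zero, sub_zero,
    div_one] at h
  linarith

/-- Equality case of Fenchel's inequality: by the tangent inequality the supremum is attained at
`x`. -/
lemma convexConjugate_gradient {f : E → ℝ} (hf : ConvexOn ℝ Set.univ f) {x : E}
    (hx : DifferentiableAt ℝ f x) :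
    convexConjugate f ((∇ f) x) = ((inner ℝ ((∇ f) x) x - f x : ℝ) : EReal) := by
  refine le_antisymm (iSup_le fun z => EReal.coe_le_coe_iff.2 ?_) (le_convexConjugate _ _ _)
  have := add_inner_gradient_le hf hx z
  rw [inner_sub_right] at this
  linarith

lemma tendsto_slope_gradient {f : E → ℝ} {x : E} (hx : DifferentiableAt ℝ f x) (v : E) :
    Filter.Tendsto (fun t : ℝ => t⁻¹ * (f (x + t • v) - f x)) (nhdsWithin 0 (Set.Ioi 0))
      (nhds (inner ℝ ((∇ f) x) v)) := by
  rw [inner_gradient_left]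
  have hline : HasDerivAt (fun t : ℝ => x + t • v) v 0 := by
    simpa using ((hasDerivAt_id (0 : ℝ)).smul_const v).const_add x
  have hx' : HasFDerivAt f (fderiv ℝ f x) (x + (0 : ℝ) • v) := by simpa using hx.hasFDerivAt
  have hd : HasDerivAt (fun t : ℝ => f (x + t • v)) (fderiv ℝ f x v) 0 :=
    hx'.comp_hasDerivAt 0 hline
  refine Filter.Tendsto.mono_left ?_
    (nhdsWithin_mono (t := {0}ᶜ) 0 fun t (ht : t ∈ Set.Ioi (0 : ℝ)) => (Set.mem_Ioi.1 ht).ne')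
  simpa using hasDerivAt_iff_tendsto_slope_zero.1 hd

variable [MeasurableSpace E] [BorelSpace E]

lemma measurable_gradient (f : E → ℝ) : Measurable (∇ f) := by
  borelize (E →L[ℝ] ℝ)
  exact (InnerProductSpace.toDual ℝ E).symm.continuous.measurable.comp (measurable_fderiv ℝ f)

/-- Uniqueness of the monotone transport from a finite measure of full support, at a point where
the two potentials touch. -/
lemma gradient_eq_of_map_eq_of_eq (γ : Measure E) [IsFiniteMeasure γ] [γ.IsOpenPosMeasure]
    {f g : E → ℝ} (hf : ConvexOn ℝ Set.univ f) (hg : ConvexOn ℝ Set.univ g)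
    (hfd : ∀ᵐ x ∂γ, DifferentiableAt ℝ f x) (hgd : ∀ᵐ x ∂γ, DifferentiableAt ℝ g x)
    (hmap : γ.map (∇ f) = γ.map (∇ g)) {x₀ : E} (hfx : DifferentiableAt ℝ f x₀)
    (hgx : DifferentiableAt ℝ g x₀) (h₀ : f x₀ = g x₀) : (∇ f) x₀ = (∇ g) x₀ := by
  by_contra hne
  have hfc : Continuous f := hf.locallyLipschitz.continuous
  have hgc : Continuous g := hg.locallyLipschitz.continuous
  set v := (∇ f) x₀ - (∇ g) x₀ with hv
  have hvpos : 0 < inner ℝ v v := real_inner_self_pos.2 (sub_ne_zero.2 hne)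
  -- Moving from `x₀` along `-v`, `f` falls below the tangent of `g` at `x₀`.
  obtain ⟨z, hz⟩ : ∃ z, f z < g x₀ + inner ℝ ((∇ g) x₀) (z - x₀) := by
    have h := (tendsto_slope_gradient hfx (-v)).eventually_lt_const
      (u := inner ℝ ((∇ g) x₀) (-v)) (by
        rw [inner_neg_right, inner_neg_right, neg_lt_neg_iff, ← sub_pos, ← inner_sub_left]
        exact hvpos)
    obtain ⟨t, ht, htpos⟩ := (h.and self_mem_nhdsWithin).exists
    have htpos : 0 < t := htpos
    refine ⟨x₀ + t • (-v), ?_⟩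
    rw [inv_mul_lt_iff₀ htpos] at ht
    rw [add_sub_cancel_left, inner_smul_right]
    linarith
  set A : Set E := {y | convexConjugate f y < convexConjugate g y} with hA
  have hAm : MeasurableSet A :=
    measurableSet_lt (measurable_convexConjugate f) (measurable_convexConjugate g)
  set M : Set E := {x | g x < f x} with hM
  have hMo : IsOpen M := isOpen_lt hgc hfc
  obtain ⟨t, htpos, ht⟩ : ∃ t : ℝ, 0 < t ∧
      f z < g x₀ - t⁻¹ * (g (x₀ + t • (x₀ - z)) - g x₀) := by
    have h := ((tendsto_slope_gradient hgx (x₀ - z)).const_sub (g x₀)).eventually_const_lt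
      (u := f z) (by
        rw [← neg_sub z x₀, inner_neg_right, sub_neg_eq_add]
        exact hz)
    obtain ⟨t, ht, htpos⟩ := (h.and self_mem_nhdsWithin).exists
    exact ⟨t, htpos, ht⟩
  -- For `x` in `N`, the tangent of `g` at `x` still passes above `f z`. The difference quotient
  -- with fixed step `t` replaces the gradient, so that `N` is open although `∇ g` need not be
  -- continuous.
  set N : Set E := {x | f z < g x - t⁻¹ * (g (x + t • (x - z)) - g x)} with hN
  have hNo : IsOpen N := isOpen_lt continuous_const (by fun_prop)
  have hMN : (M ∩ N).Nonempty := by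
    have h1 : ∀ᶠ s : ℝ in nhdsWithin 0 (Set.Ioi 0), x₀ + s • v ∈ M := by
      have h := ((tendsto_slope_gradient hfx v).sub
        (tendsto_slope_gradient hgx v)).eventually_const_lt (u := 0) (by
          rw [← inner_sub_left]; exact hvpos)
      filter_upwards [h, self_mem_nhdsWithin] with s hs hspos
      have hspos : 0 < s := hspos
      rw [← mul_sub, h₀] at hs
      have := (pos_iff_pos_of_mul_pos hs).1 (inv_pos.2 hspos)
      change g _ < f _
      linarith
    have h2 : ∀ᶠ s : ℝ in nhdsWithin 0 (Set.Ioi 0), x₀ + s • v ∈ N := by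
      have hc : Continuous fun s : ℝ => x₀ + s • v := by fun_prop
      exact (hc.tendsto' 0 x₀ (by simp)).mono_left nhdsWithin_le_nhds (hNo.mem_nhds ht)
    obtain ⟨s, hs⟩ := (h1.and h2).exists
    exact ⟨_, hs⟩
  -- `∇ f` sends `M` into `A`, while `∇ g` reaches `A` only from `M \ N`. Equal image measures then
  -- force the nonempty open set `M ∩ N` to be null.
  have hle1 : γ M ≤ γ ((∇ f) ⁻¹' A) := by
    refine measure_mono_ae ?_
    filter_upwards [hfd] with x hx hxM
    change convexConjugate f _ < convexConjugate g _
    rw [convexConjugate_gradient hf hx]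
    refine lt_of_lt_of_le (EReal.coe_lt_coe_iff.2 ?_) (le_convexConjugate g _ x)
    exact sub_lt_sub_left hxM _
  have hle2 : γ ((∇ g) ⁻¹' A) ≤ γ (M \ N) := by
    refine measure_mono_ae ?_
    filter_upwards [hgd] with x hx hxA
    change convexConjugate f _ < convexConjugate g _ at hxA
    rw [convexConjugate_gradient hg hx] at hxA
    have hlt (w : E) : inner ℝ ((∇ g) x) w - f w < inner ℝ ((∇ g) x) x - g x :=
      EReal.coe_lt_coe_iff.1 ((le_convexConjugate f _ w).trans_lt hxA)
    refine ⟨(sub_lt_sub_iff_left _).1 (hlt x), fun hxN => ?_⟩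
    have hxN : f z < g x - t⁻¹ * (g (x + t • (x - z)) - g x) := hxN
    have h1 := add_inner_gradient_le hg hx (x + t • (x - z))
    rw [add_sub_cancel_left, inner_smul_right, inner_sub_right] at h1
    have h2 : inner ℝ ((∇ g) x) x - inner ℝ ((∇ g) x) z ≤
        t⁻¹ * (g (x + t • (x - z)) - g x) := by
      rw [le_inv_mul_iff₀ htpos]
      linarith
    linarith [hlt z]
  have hmapA : γ ((∇ f) ⁻¹' A) = γ ((∇ g) ⁻¹' A) := by
    rw [← Measure.map_apply (measurable_gradient f) hAm, hmap,
      Measure.map_apply (measurable_gradient g) hAm]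
  have hpos : 0 < γ (M ∩ N) := (hMo.inter hNo).measure_pos γ hMN
  have hsplit : γ (M ∩ N) + γ (M \ N) = γ M := measure_inter_add_sdiff M hNo.measurableSet
  have hle : γ (M ∩ N) + γ (M \ N) ≤ 0 + γ (M \ N) := by
    rw [hsplit, zero_add]
    exact hle1.trans (hmapA.le.trans hle2)
  exact hpos.not_ge ((ENNReal.add_le_add_iff_right (measure_ne_top γ _)).1 hle)

/-- Uniqueness of the monotone transport from a finite measure of full support. -/
lemma gradient_ae_eq_of_map_eq (γ : Measure E) [IsFiniteMeasure γ] [γ.IsOpenPosMeasure]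
    {f g : E → ℝ} (hf : ConvexOn ℝ Set.univ f) (hg : ConvexOn ℝ Set.univ g)
    (hfd : ∀ᵐ x ∂γ, DifferentiableAt ℝ f x) (hgd : ∀ᵐ x ∂γ, DifferentiableAt ℝ g x)
    (hmap : γ.map (∇ f) = γ.map (∇ g)) : ∇ f =ᵐ[γ] ∇ g := by
  filter_upwards [hfd, hgd] with x hfx hgx
  -- Adding a constant to `g` makes the potentials touch at `x` and leaves the gradient unchanged.
  have hgrad : ∇ (fun y => g y + (f x - g x)) = ∇ g := by
    ext1 y
    simp [gradient, fderiv_add_const]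
  have h := gradient_eq_of_map_eq_of_eq γ (g := fun y => g y + (f x - g x)) hf
    (hg.add_const _) hfd (by filter_upwards [hgd] with y hy using hy.add_const _)
    (by rw [hgrad, hmap]) hfx (hgx.add_const _) (by ring)
  rwa [hgrad] at h

end Convex

/-! ### Gaussian integrals of Hermite polynomials. -/

section Gaussian

open Polynomial in
lemma aeval_hermite_succ_eq_sub_derivative (n : ℕ) (x : ℝ) :
    aeval x (hermite (n + 1)) = x * aeval x (hermite n) - aeval x (derivative (hermite n)) := by
  simp [hermite_succ]

lemma integrable_aeval_gaussianReal (p : Polynomial ℤ) :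
    Integrable (fun x : ℝ => Polynomial.aeval x p) (gaussianReal 0 1) := by
  simp_rw [Polynomial.aeval_eq_sum_range]
  refine integrable_finsetSum _ fun i _ => ?_
  simp_rw [zsmul_eq_mul]
  refine Integrable.const_mul ?_ _
  refine (integrable_norm_iff (by fun_prop)).1 ?_
  simpa using (memLp_id_gaussianReal' (i : ENNReal) (by simp)).integrable_norm_pow'

/-- Hₙ₊₁ times the density is minus the derivative of Hₙ times the density, and both products are
integrable on the line. -/
lemma integral_aeval_hermite_succ (n : ℕ) :
    ∫ x, Polynomial.aeval x (Polynomial.hermite (n + 1)) ∂(gaussianReal 0 1) = 0 := by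
  have hint (p : Polynomial ℤ) :
      Integrable fun x : ℝ => gaussianPDFReal 0 1 x * Polynomial.aeval x p := by
    have h := integrable_aeval_gaussianReal p
    rw [gaussianReal_of_var_ne_zero 0 one_ne_zero,
      integrable_withDensity_iff_integrable_smul' (measurable_gaussianPDF 0 1)
        (by simp [gaussianPDF])] at h
    simpa [gaussianPDF, ENNReal.toReal_ofReal (gaussianPDFReal_nonneg 0 1 _)] using h
  have hder (x : ℝ) : HasDerivAt
      (fun x => gaussianPDFReal 0 1 x * Polynomial.aeval x (Polynomial.hermite n))
      (-(gaussianPDFReal 0 1 x * Polynomial.aeval x (Polynomial.hermite (n + 1)))) x := by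
    have hg : HasDerivAt (gaussianPDFReal 0 1) (-x * gaussianPDFReal 0 1 x) x := by
      have h1 : HasDerivAt (fun x : ℝ => -(x - 0) ^ 2 / (2 * ((1 : NNReal) : ℝ))) (-x) x := by
        refine ((((hasDerivAt_id x).sub_const 0).pow 2).neg.div_const
          (2 * ((1 : NNReal) : ℝ))).congr_deriv ?_
        simp only [id, sub_zero, NNReal.coe_one, Nat.cast_ofNat]
        ring
      refine (h1.exp.const_mul ((√(2 * Real.pi * ((1 : NNReal) : ℝ)))⁻¹)).congr_deriv ?_
      simp only [gaussianPDFReal]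
      ring
    refine (hg.mul (Polynomial.hasDerivAt_aeval (Polynomial.hermite n) x)).congr_deriv ?_
    rw [aeval_hermite_succ_eq_sub_derivative]
    ring
  have h := integral_eq_zero_of_hasDerivAt_of_integrable hder (hint _).neg (hint _)
  rw [integral_neg, neg_eq_zero] at h
  rw [integral_gaussianReal_eq_integral_smul one_ne_zero]
  simpa using h

instance isOpenPosMeasure_gaussianReal : (gaussianReal 0 1).IsOpenPosMeasure :=
  (gaussianReal_absolutelyContinuous' 0 one_ne_zero).isOpenPosMeasure

variable {ι : Type*} [Fintype ι]

instance isOpenPosMeasure_stdGaussian :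
    (stdGaussian (EuclideanSpace ℝ ι)).IsOpenPosMeasure := by
  rw [← map_pi_eq_stdGaussian]
  exact (PiLp.continuous_toLp 2 _).isOpenPosMeasure_map (WithLp.toLp_surjective 2)

variable {d : ℕ}

lemma integrable_hermitePoly (α : Fin d → ℕ+) :
    Integrable (hermitePoly α) (stdGaussian (EuclideanSpace ℝ (Fin d))) := by
  rw [← map_pi_eq_stdGaussian]
  refine (integrable_map_equiv (MeasurableEquiv.toLp 2 (Fin d → ℝ)) (hermitePoly α)).2 ?_
  exact Integrable.fintype_prod fun k => integrable_aeval_gaussianReal _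

lemma integral_hermitePoly (α : Fin d → ℕ+) :
    ∫ x, hermitePoly α x ∂(stdGaussian (EuclideanSpace ℝ (Fin d))) =
      if α = (fun _ => 1) then 1 else 0 := by
  rw [← map_pi_eq_stdGaussian]
  refine (integral_map_equiv (MeasurableEquiv.toLp 2 (Fin d → ℝ)) (hermitePoly α)).trans ?_
  refine (integral_fintype_prod_eq_prod (fun k (x : ℝ) =>
    Polynomial.aeval x (Polynomial.hermite ((α k : ℕ) - 1)))).trans ?_
  split_ifs with h
  · simp [h]
  · obtain ⟨k, hk⟩ := Function.ne_iff.1 h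
    refine Finset.prod_eq_zero (Finset.mem_univ k) ?_
    have hk' : (α k : ℕ) ≠ 1 := by simpa using hk
    obtain ⟨n, hn⟩ : ∃ n, (α k : ℕ) - 1 = n + 1 :=
      ⟨(α k : ℕ) - 2, by have := (α k).pos; omega⟩
    rw [hn]
    exact integral_aeval_hermite_succ n

end Gaussian

/-! ### Transports and L-moments of transformed laws. -/

section Transport

variable {d : ℕ} {φ ψ : EuclideanSpace ℝ (Fin d) → ℝ}
  {ν : Measure (EuclideanSpace ℝ (Fin d))}

lemma IsTransportPotential.monotoneTransport_ae_eq (hφ : IsTransportPotential φ ν) :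
    monotoneTransport ν =ᵐ[stdGaussian (EuclideanSpace ℝ (Fin d))] ∇ φ := by
  have hex : ∃ φ : EuclideanSpace ℝ (Fin d) → ℝ, IsTransportPotential φ ν := ⟨φ, hφ⟩
  have hc := hex.choose_spec
  rw [monotoneTransport, dif_pos hex]
  exact gradient_ae_eq_of_map_eq _ hc.convex hφ.convex hc.differentiable hφ.differentiable
    (hc.map_gradient.trans hφ.map_gradient.symm)

/-- A convex function with an almost everywhere prescribed gradient is a transport potential. -/
lemma isTransportPotential_of_hasGradientAt (hφ : ConvexOn ℝ Set.univ φ)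
    {T : EuclideanSpace ℝ (Fin d) → EuclideanSpace ℝ (Fin d)}
    (hT : ∀ᵐ x ∂(stdGaussian (EuclideanSpace ℝ (Fin d))), HasGradientAt φ (T x) x)
    (hmap : (stdGaussian (EuclideanSpace ℝ (Fin d))).map T = ν) : IsTransportPotential φ ν where
  convex := hφ
  differentiable := by filter_upwards [hT] with x hx using hx.differentiableAt
  map_gradient := by
    rw [← hmap]
    refine Measure.map_congr ?_
    filter_upwards [hT] with x hx using hx.gradient

lemma IsTransportPotential.ae_hasGradientAt (hφ : IsTransportPotential φ ν) :
    ∀ᵐ x ∂(stdGaussian (EuclideanSpace ℝ (Fin d))), HasGradientAt φ ((∇ φ) x) x := by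
  filter_upwards [hφ.differentiable] with x hx using hx.hasGradientAt

lemma monotoneTransport_ae_eq_of_hasGradientAt (hφ : ConvexOn ℝ Set.univ φ)
    {T : EuclideanSpace ℝ (Fin d) → EuclideanSpace ℝ (Fin d)}
    (hT : ∀ᵐ x ∂(stdGaussian (EuclideanSpace ℝ (Fin d))), HasGradientAt φ (T x) x)
    (hmap : (stdGaussian (EuclideanSpace ℝ (Fin d))).map T = ν) :
    monotoneTransport ν =ᵐ[stdGaussian (EuclideanSpace ℝ (Fin d))] T := by
  refine (isTransportPotential_of_hasGradientAt hφ hT hmap).monotoneTransport_ae_eq.trans ?_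
  filter_upwards [hT] with x hx using hx.gradient

/-- The monotone transport onto the image of a law under a positive homothety and a translation. -/
lemma IsTransportPotential.monotoneTransport_map_smul_add (hφ : IsTransportPotential φ ν)
    {σ : ℝ} (hσ : 0 < σ) (m : EuclideanSpace ℝ (Fin d)) :
    monotoneTransport (ν.map fun y => σ • y + m)
      =ᵐ[stdGaussian (EuclideanSpace ℝ (Fin d))] fun x => σ • (∇ φ) x + m := by
  refine monotoneTransport_ae_eq_of_hasGradientAt (φ := fun x => σ • φ x + inner ℝ m x)
    ((hφ.convex.smul hσ.le).add ((innerSL ℝ m).toLinearMap.convexOn convex_univ)) ?_ ?_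
  · filter_upwards [hφ.ae_hasGradientAt] with x hx
    rw [hasGradientAt_iff_hasFDerivAt] at hx ⊢
    rw [map_add, map_smul]
    exact (hx.const_smul σ).add (innerSL ℝ m).hasFDerivAt
  · rw [← hφ.map_gradient, Measure.map_map (by fun_prop) (measurable_gradient φ)]
    rfl

/-- The monotone transport onto the image of a law under a linear isometry. -/
lemma IsTransportPotential.monotoneTransport_map_symm (hφ : IsTransportPotential φ ν)
    (U : EuclideanSpace ℝ (Fin d) ≃ₗᵢ[ℝ] EuclideanSpace ℝ (Fin d)) :
    monotoneTransport (ν.map U.symm)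
      =ᵐ[stdGaussian (EuclideanSpace ℝ (Fin d))] fun x => U.symm ((∇ φ) (U x)) := by
  have hU : MeasurePreserving U (stdGaussian (EuclideanSpace ℝ (Fin d)))
      (stdGaussian (EuclideanSpace ℝ (Fin d))) :=
    ⟨U.continuous.measurable, stdGaussian_map U⟩
  refine monotoneTransport_ae_eq_of_hasGradientAt (φ := fun x => φ (U x))
    (hφ.convex.comp_linearMap U.toLinearEquiv.toLinearMap) ?_ ?_
  · filter_upwards [hU.quasiMeasurePreserving.ae hφ.ae_hasGradientAt] with x hx
    rw [hasGradientAt_iff_hasFDerivAt] at hx ⊢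
    refine (hx.comp x U.toContinuousLinearEquiv.hasFDerivAt).congr_fderiv ?_
    ext w
    -- The adjoint of the isometry `U` is its inverse.
    change inner ℝ ((∇ φ) (U x)) (U w) = inner ℝ (U.symm ((∇ φ) (U x))) w
    rw [← U.inner_map_map (U.symm _), U.apply_symm_apply]
  · have hm : (fun x => U.symm ((∇ φ) (U x))) = U.symm ∘ (∇ φ) ∘ U := rfl
    rw [hm, ← Measure.map_map U.symm.continuous.measurable
        ((measurable_gradient φ).comp U.continuous.measurable),
      ← Measure.map_map (measurable_gradient φ) U.continuous.measurable, stdGaussian_map,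
      hφ.map_gradient]

lemma exists_linearIsometryEquiv_of_mem_orthogonalGroup {P : Matrix (Fin d) (Fin d) ℝ}
    (hP : P ∈ Matrix.orthogonalGroup (Fin d) ℝ) :
    ∃ U : EuclideanSpace ℝ (Fin d) ≃ₗᵢ[ℝ] EuclideanSpace ℝ (Fin d),
      ∀ x, U.symm x = WithLp.toLp 2 (P.transpose.mulVec x.ofLp) := by
  refine ⟨Unitary.linearIsometryEquiv ⟨Matrix.toEuclideanCLM (𝕜 := ℝ) P,
    Unitary.map_mem (Matrix.toEuclideanCLM (𝕜 := ℝ) (n := Fin d)) hP⟩, fun x => ?_⟩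
  rw [LinearIsometryEquiv.symm_apply_eq]
  change x = Matrix.toEuclideanCLM (𝕜 := ℝ) P _
  have h : P * P.transpose = 1 := (Matrix.mem_orthogonalGroup_iff _ _).1 hP
  rw [Matrix.toEuclideanCLM_toLp, Matrix.mulVec_mulVec, h, Matrix.one_mulVec]

lemma IsTransportPotential.hermiteLMoment_map_smul_add (hφ : IsTransportPotential φ ν)
    {α : Fin d → ℕ+}
    (hα : Integrable (fun x => hermitePoly α x • (∇ φ) x)
      (stdGaussian (EuclideanSpace ℝ (Fin d))))
    {σ : ℝ} (hσ : 0 < σ) (m : EuclideanSpace ℝ (Fin d)) :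
    HasHermiteLMoment (ν.map fun y => σ • y + m) α ∧
      hermiteLMoment (ν.map fun y => σ • y + m) α =
        σ • (∫ x, hermitePoly α x • (∇ φ) x ∂(stdGaussian (EuclideanSpace ℝ (Fin d)))) +
          if α = (fun _ => 1) then m else 0 := by
  have hae : (fun x => hermitePoly α x • monotoneTransport (ν.map fun y => σ • y + m) x)
      =ᵐ[stdGaussian (EuclideanSpace ℝ (Fin d))]
        fun x => σ • hermitePoly α x • (∇ φ) x + hermitePoly α x • m := by
    filter_upwards [hφ.monotoneTransport_map_smul_add hσ m] with x hx
    rw [hx, smul_add, smul_comm]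
  have hm := (integrable_hermitePoly α).smul_const m
  refine ⟨((hα.smul σ).add hm).congr hae.symm, ?_⟩
  rw [hermiteLMoment, integral_congr_ae hae]
  refine (integral_add (hα.smul σ) hm).trans ?_
  rw [integral_smul_const, integral_hermitePoly, ite_smul, one_smul, zero_smul]
  congr 1
  exact integral_smul σ _

lemma IsTransportPotential.hermiteLMatrix_map_transpose (hφ : IsTransportPotential φ ν)
    (hint : ∀ i j, Integrable (fun x => (∇ φ) x i * x j)
      (stdGaussian (EuclideanSpace ℝ (Fin d))))
    {P : Matrix (Fin d) (Fin d) ℝ} (hP : P ∈ Matrix.orthogonalGroup (Fin d) ℝ) :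
    HasHermiteLMatrix (ν.map fun y => WithLp.toLp 2 (P.transpose.mulVec y.ofLp)) ∧
      hermiteLMatrix (ν.map fun y => WithLp.toLp 2 (P.transpose.mulVec y.ofLp)) =
        P.transpose * (Matrix.of fun i j =>
          ∫ x, (∇ φ) x i * x j ∂(stdGaussian (EuclideanSpace ℝ (Fin d)))) * P := by
  obtain ⟨U, hU⟩ := exists_linearIsometryEquiv_of_mem_orthogonalGroup hP
  have hUfun : (fun y : EuclideanSpace ℝ (Fin d) =>
      WithLp.toLp 2 (P.transpose.mulVec y.ofLp)) = U.symm := funext fun y => (hU y).symm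
  have hUcoord (y : EuclideanSpace ℝ (Fin d)) (i : Fin d) :
      U.symm y i = ∑ k, P k i * y k := by
    rw [hU]
    simp [Matrix.mulVec, dotProduct]
  have hpres : MeasurePreserving U (stdGaussian (EuclideanSpace ℝ (Fin d)))
      (stdGaussian (EuclideanSpace ℝ (Fin d))) :=
    ⟨U.continuous.measurable, stdGaussian_map U⟩
  set G : Fin d → Fin d → EuclideanSpace ℝ (Fin d) → ℝ := fun i j y =>
    ∑ l, ∑ k, P k i * ((∇ φ) y k * y l) * P l j with hG
  have hterm (i j l k : Fin d) : Integrable (fun y => P k i * ((∇ φ) y k * y l) * P l j)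
      (stdGaussian (EuclideanSpace ℝ (Fin d))) := ((hint k l).const_mul _).mul_const _
  have hGint (i j : Fin d) : Integrable (G i j) (stdGaussian (EuclideanSpace ℝ (Fin d))) :=
    integrable_finsetSum _ fun l _ => integrable_finsetSum _ fun k _ => hterm i j l k
  have hae (i j : Fin d) : (fun x => monotoneTransport (ν.map U.symm) x i * x j)
      =ᵐ[stdGaussian (EuclideanSpace ℝ (Fin d))] fun x => G i j (U x) := by
    filter_upwards [hφ.monotoneTransport_map_symm U] with x hx
    rw [hx, hUcoord]
    -- Writing `x` as `U.symm (U x)` turns the integrand into a function of `U x` alone, and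
    -- invariance of the Gaussian then removes `U`.
    conv_lhs => rw [← U.symm_apply_apply x, hUcoord, U.symm_apply_apply]
    rw [Finset.sum_mul_sum, Finset.sum_comm]
    exact Finset.sum_congr rfl fun l _ => Finset.sum_congr rfl fun k _ => by ring
  rw [hUfun]
  refine ⟨fun i j => (hpres.integrable_comp_of_integrable (hGint i j)).congr (hae i j).symm, ?_⟩
  ext i j
  rw [hermiteLMatrix, Matrix.of_apply, integral_congr_ae (hae i j),
    hpres.integral_comp U.toHomeomorph.measurableEmbedding (G i j), hG,
    integral_finsetSum _ fun l _ => integrable_finsetSum _ fun k _ => hterm i j l k,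
    Matrix.mul_apply]
  refine Finset.sum_congr rfl fun l _ => ?_
  rw [integral_finsetSum _ fun k _ => hterm i j l k, Matrix.mul_apply, Finset.sum_mul]
  refine Finset.sum_congr rfl fun k _ => ?_
  rw [integral_mul_const, integral_const_mul]
  rfl

end Transport

end HermiteLMoments

theorem mainTheorem9 {d : ℕ} {Ω : Type*} [MeasurableSpace Ω] (μ : Measure Ω)
    [IsProbabilityMeasure μ] (X : Ω → EuclideanSpace ℝ (Fin d)) (hX : AEMeasurable X μ)
    (φ : EuclideanSpace ℝ (Fin d) → ℝ)
    (hφ : HermiteLMoments.IsTransportPotential φ (μ.map X)) :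
    (∀ α : Fin d → ℕ+,
      Integrable (fun x => HermiteLMoments.hermitePoly α x • (∇ φ) x)
        (stdGaussian (EuclideanSpace ℝ (Fin d))) →
      HermiteLMoments.hermiteLMoment (μ.map X) α =
          ∫ x, HermiteLMoments.hermitePoly α x • (∇ φ) x
            ∂(stdGaussian (EuclideanSpace ℝ (Fin d))) ∧
        ∀ (σ : ℝ) (m : EuclideanSpace ℝ (Fin d)), 0 < σ →
          HermiteLMoments.HasHermiteLMoment (μ.map fun ω => σ • X ω + m) α ∧
          HermiteLMoments.hermiteLMoment (μ.map fun ω => σ • X ω + m) α =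
            σ • HermiteLMoments.hermiteLMoment (μ.map X) α +
              if α = (fun _ => 1) then m else 0) ∧
    ((∀ i j, Integrable (fun x => (∇ φ) x i * x j)
        (stdGaussian (EuclideanSpace ℝ (Fin d)))) →
      HermiteLMoments.hermiteLMatrix (μ.map X) =
          (Matrix.of fun i j =>
            ∫ x, (∇ φ) x i * x j ∂(stdGaussian (EuclideanSpace ℝ (Fin d)))) ∧
        ∀ P ∈ Matrix.orthogonalGroup (Fin d) ℝ,
          HermiteLMoments.HasHermiteLMatrix
            (μ.map fun ω => WithLp.toLp 2 (P.transpose.mulVec (X ω).ofLp)) ∧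
          HermiteLMoments.hermiteLMatrix
              (μ.map fun ω => WithLp.toLp 2 (P.transpose.mulVec (X ω).ofLp)) =
            P.transpose * HermiteLMoments.hermiteLMatrix (μ.map X) * P) := by
  have hmap (g : EuclideanSpace ℝ (Fin d) → EuclideanSpace ℝ (Fin d)) (hg : Continuous g) :
      (μ.map fun ω => g (X ω)) = (μ.map X).map g :=
    (AEMeasurable.map_map_of_aemeasurable hg.aemeasurable hX).symm
  have hae := hφ.monotoneTransport_ae_eq
  refine ⟨fun α hα => ?_, fun hint => ?_⟩
  · have hval : HermiteLMoments.hermiteLMoment (μ.map X) α =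
        ∫ x, HermiteLMoments.hermitePoly α x • (∇ φ) x
          ∂(stdGaussian (EuclideanSpace ℝ (Fin d))) := by
      refine integral_congr_ae ?_
      filter_upwards [hae] with x hx
      rw [hx]
    refine ⟨hval, fun σ m hσ => ?_⟩
    rw [hmap (fun y => σ • y + m) (by fun_prop), hval]
    exact hφ.hermiteLMoment_map_smul_add hα hσ m
  · have hval : HermiteLMoments.hermiteLMatrix (μ.map X) = Matrix.of fun i j =>
        ∫ x, (∇ φ) x i * x j ∂(stdGaussian (EuclideanSpace ℝ (Fin d))) := by
      ext i j
      refine integral_congr_ae ?_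
      filter_upwards [hae] with x hx
      rw [hx]
    refine ⟨hval, fun P hP => ?_⟩
    rw [hmap (fun y => WithLp.toLp 2 (P.transpose.mulVec y.ofLp)) (by fun_prop), hval]
    exact hφ.hermiteLMatrix_map_transpose hint hP
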